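/- Consider the Newtonian $N$-body problem in $\mathbb R^3$ with masses $m_1,\dots,m_N>0$ and gravitational constant $G>0$. On $\mathbb E=(\mathbb R^3)^N$ put the mass inner product $\langle v,w\rangle=\sum_a m_a\, v_a\cdot w_a$, let $U(q)=G\sum_{a<b} m_am_b/|q_a-q_b|$ on collision-free configurations, and let solutions be the maximal collision-free solutions $q:I\to\mathbb E$ ($I\subseteq\mathbb R$ an open interval) of $\ddot q=\nabla U(q)$, the gradient being that of the mass inner product. The energy $E=\tfrac12\langle\dot q,\dot q\rangle-U(q)$ is constant along each solution. Fix $h>0$. Then: (i) There is $\varepsilon>0$ such that every solution of energy $E=-h$ that starts in the collar $\{h\le U\le h+\varepsilon\}$ (that is, lies in it at some time $t_0\in I$) leaves this collar in finite time: there is $t\in I$, $t>t_0$, at which $q(t)$ is not in the collar. (ii) There are constants $\varepsilon_0>0$, $K>1$, $C>0$, depending only on $N$, $G$, the masses and $h$, such that the following holds for all $0<\varepsilon<\varepsilon_0$. If a solution $q$ of energy $E=-h$ satisfies $U(q(t_0))\le h+\varepsilon$ at some time $t_0\in I$, then there are $t_1<t_0<t_2$ in $I$ with $t_2-t_1<C\sqrt{\varepsilon}$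 such that $U(q(t))<h+K\varepsilon$ for $t_1<t<t_2$, $U(q(t_1))=U(q(t_2))=h+K\varepsilon$, and $q$ crosses the hypersurface $\{U=h+K\varepsilon\}$ transversally at both times, entering $\{U\le h+K\varepsilon\}$ at $t_1$ and exiting it at $t_2$: $dU(q(t_1))(\dot q(t_1))<0<dU(q(t_2))(\dot q(t_2))$. -/

import Mathlib

noncomputable section

namespace NBody

/-- The configuration space `𝔼 = (ℝ³)ᴺ`; `q a` is the position of the `a`-th body. The sup norm
that Lean puts on this finite-dimensional space is used only through its topology; the geometry is
that of `massInner`. -/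
abbrev Config (N : ℕ) : Type := Fin N → EuclideanSpace ℝ (Fin 3)

/-- The mass inner product `⟨v, w⟩ = ∑ₐ mₐ ⟨vₐ, wₐ⟩` on `𝔼`. -/
def massInner {N : ℕ} (m : Fin N → ℝ) (v w : Config N) : ℝ :=
  ∑ a, m a * inner ℝ (v a) (w a)

/-- The configuration `q` is not a collision: no two bodies are at the same place. Collisions are
exactly the points where the Newtonian potential function is `+∞`. -/
def CollisionFree {N : ℕ} (q : Config N) : Prop :=
  Function.Injective q

/-- The potential function `U(q) = G ∑_{a < b} mₐ m_b / r_{ab}` (the negative of the potential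
energy). Its values are meaningful at collision-free configurations, and it is only evaluated
there. -/
def potential {N : ℕ} (G : ℝ) (m : Fin N → ℝ) (q : Config N) : ℝ :=
  G * ∑ a, ∑ b ∈ Finset.Ioi a, m a * m b / dist (q a) (q b)

/-- The energy `½ ⟨v, v⟩ - U(q)`. -/
def energy {N : ℕ} (G : ℝ) (m : Fin N → ℝ) (q v : Config N) : ℝ :=
  massInner m v v / 2 - potential G m q

/-- `g` is the gradient at `q` of `f` with respect to the mass inner product. -/
def HasMassGradientAt {N : ℕ} (m : Fin N → ℝ) (f : Config N → ℝ) (g q : Config N) : Prop :=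
  DifferentiableAt ℝ f q ∧ ∀ w, fderiv ℝ f q w = massInner m g w

/-- `q` is a (collision-free) solution on the open time interval `I` of Newton's equations
`q'' = ∇U(q)`, the gradient being taken with respect to the mass inner product. Only the values of
`q` on `I` matter. -/
structure IsSolution {N : ℕ} (G : ℝ) (m : Fin N → ℝ) (q : ℝ → Config N) (I : Set ℝ) : Prop where
  isOpen : IsOpen I
  ordConnected : I.OrdConnected
  collisionFree : ∀ t ∈ I, CollisionFree (q t)
  differentiableAt : ∀ t ∈ I, DifferentiableAt ℝ q t
  newton : ∀ t ∈ I, ∃ g, HasMassGradientAt m (potential G m) g (q t) ∧ HasDerivAt (deriv q) g t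

/-- A maximal solution: one that cannot be extended, as a collision-free solution, to a larger
open time interval. -/
def IsMaximalSolution {N : ℕ} (G : ℝ) (m : Fin N → ℝ) (q : ℝ → Config N) (I : Set ℝ) : Prop :=
  IsSolution G m q I ∧
    ∀ (q' : ℝ → Config N) (I' : Set ℝ),
      IsSolution G m q' I' → I ⊆ I' → Set.EqOn q q' I → I' = I

/-- The collar `{h ≤ U ≤ h + ε}` of the Hill boundary `{U = h}`. -/
def hillCollar {N : ℕ} (G : ℝ) (m : Fin N → ℝ) (h ε : ℝ) : Set (Config N) :=
  {q | CollisionFree q ∧ h ≤ potential G m q ∧ potential G m q ≤ h + ε}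

end NBody

end

/-! ### Derivatives of the potential, the mass gradient and conservation of energy. -/

noncomputable section
namespace NBody

variable {N : ℕ}

/-! At energy `-h` the squared speed is `2(U - h)`, so `U ≥ h` and the motion is slow in a thin
collar. Along a solution `U'' = |∇U|² + D²U(q', q')`. Where `U ≤ 2h` the bodies are uniformly
separated (`exists_pos_le_dist`), so the Hessian term is at least `-A|q'|²`. If `|∇U|² ≥ c > 0` on
`{U ≥ h}`, then `U'' ≥ c/2` in a thin collar (`exists_convexity_constants`).

The crux is this gradient bound, `exists_pos_le_massInner_acceleration`. Compactness is unavailable,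
since clusters can recede from each other. Instead, choose a scale `R` from a finite list such that
no mutual distance lies in `(R, 3R]`, and dilate each cluster about one of its points. Within
clusters this lowers `U` at the rate of the internal potential, while pairs in different clusters
contribute only `O(1/R)`. So `dU(w) ≤ -h/2` for a vector `w` of bounded length, and Cauchy–Schwarz
finishes.

The rest is calculus. A function with values in `[0, L]` and second derivative at least `β` lives
for a time at most `√(8L/β)` (`mul_sq_le_of_le_deriv2`), and a convex function crosses a higher
level with positive slope (`exists_first_crossing`). A solution cannot end inside the collar,
because bounded `U` allows continuation (`IsMaximalSolution.Ici_subset`). Time reversal gives the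
entry from the exit. -/

/-- The directional derivative of the potential at `q` along `w`. -/
def potentialDeriv (G : ℝ) (m : Fin N → ℝ) (q w : Config N) : ℝ :=
  -(G / 2) * ∑ a, ∑ b, m a * m b * (inner ℝ (q a - q b) (w a - w b) / dist (q a) (q b) ^ 3)

/-- The acceleration field of the `N`-body problem. -/
def acceleration (G : ℝ) (m : Fin N → ℝ) (q : Config N) : Config N :=
  fun a => G • ∑ b, (m b / dist (q a) (q b) ^ 3) • (q b - q a)

/-- The symmetric form lets later sums run over all ordered pairs; diagonal terms vanish because `x
/ 0 = 0`. -/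
theorem potential_eq_half_sum (G : ℝ) (m : Fin N → ℝ) (q : Config N) :
    potential G m q = G / 2 * ∑ a, ∑ b, m a * m b / dist (q a) (q b) := by
  have h1 := Finset.sum_sum_Ioi_add_eq_sum_sum_off_diag
    (fun a b : Fin N => m a * m b / dist (q a) (q b))
  have h2 : ∀ a b : Fin N, m b * m a / dist (q b) (q a) + m a * m b / dist (q a) (q b)
      = 2 * (m a * m b / dist (q a) (q b)) := by
    intro a b; rw [dist_comm (q b), mul_comm (m b)]; ring
  have h3 : ∑ a, ∑ b, m a * m b / dist (q a) (q b)
      = ∑ a, ∑ b ∈ {a}ᶜ, m b * m a / dist (q b) (q a) := by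
    refine Finset.sum_congr rfl fun a _ => ?_
    rw [Fintype.sum_eq_add_sum_compl a]
    simp only [dist_self, div_zero, zero_add]
    exact Finset.sum_congr rfl fun b _ => by rw [dist_comm, mul_comm (m b)]
  rw [h3, ← h1]
  simp only [h2, ← Finset.mul_sum, potential]
  ring

theorem hasDerivAt_dist_comp {E : Type*} [NormedAddCommGroup E] [InnerProductSpace ℝ E]
    {x y : ℝ → E} {x' y' : E} {t : ℝ} (hx : HasDerivAt x x' t) (hy : HasDerivAt y y' t)
    (hne : x t ≠ y t) :
    HasDerivAt (fun s => dist (x s) (y s)) (inner ℝ (x t - y t) (x' - y') / dist (x t) (y t)) t := by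
  have h0 : dist (x t) (y t) ≠ 0 := dist_ne_zero.2 hne
  have h1 := ((hx.sub hy).norm_sq).sqrt (by
    simpa [sub_eq_zero] using hne)
  have h2 : (fun s => √(‖(x - y) s‖ ^ 2)) = fun s => dist (x s) (y s) := by
    funext s
    rw [Real.sqrt_sq (norm_nonneg _), dist_eq_norm]; rfl
  rw [h2] at h1
  convert h1 using 1
  rw [Real.sqrt_sq (norm_nonneg _), Pi.sub_apply, ← dist_eq_norm]
  field_simp

theorem hasDerivAt_potential_comp (G : ℝ) (m : Fin N → ℝ) {c : ℝ → Config N} {v : Config N}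
    {t : ℝ} (hc : HasDerivAt c v t) (hcf : CollisionFree (c t)) :
    HasDerivAt (fun s => potential G m (c s)) (potentialDeriv G m (c t) v) t := by
  have h : ∀ a b : Fin N, HasDerivAt (fun s => m a * m b / dist (c s a) (c s b))
      (-(m a * m b * (inner ℝ (c t a - c t b) (v a - v b) / dist (c t a) (c t b) ^ 3))) t := by
    intro a b
    by_cases hab : a = b
    · subst hab; simpa using hasDerivAt_const t (0 : ℝ)
    · have hne : c t a ≠ c t b := fun e => hab (hcf e)
      have h0 : dist (c t a) (c t b) ≠ 0 := dist_ne_zero.2 hne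
      have h1 := ((hasDerivAt_dist_comp (hasDerivAt_pi.1 hc a) (hasDerivAt_pi.1 hc b) hne).inv
        h0).const_mul (m a * m b)
      simp only [div_eq_mul_inv]
      refine h1.congr_deriv ?_
      field_simp
  simp only [potential_eq_half_sum]
  refine ((HasDerivAt.fun_sum fun a _ => HasDerivAt.fun_sum fun b _ => h a b).const_mul
    (G / 2)).congr_deriv ?_
  simp [potentialDeriv]

theorem contDiffAt_dist_apply {n : WithTop ℕ∞} {q : Config N} (hq : CollisionFree q)
    {a b : Fin N} (hab : a ≠ b) :
    ContDiffAt ℝ n (fun p : Config N => dist (p a) (p b)) q := by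
  have hne : q a ≠ q b := fun e => hab (hq e)
  exact ContDiffAt.dist ℝ (contDiff_apply ℝ (EuclideanSpace ℝ (Fin 3)) a).contDiffAt (contDiff_apply ℝ (EuclideanSpace ℝ (Fin 3)) b).contDiffAt hne

theorem contDiffAt_potential {n : WithTop ℕ∞} (G : ℝ) (m : Fin N → ℝ) {q : Config N}
    (hq : CollisionFree q) : ContDiffAt ℝ n (potential G m) q := by
  unfold potential
  refine contDiffAt_const.mul (ContDiffAt.sum fun a _ => ContDiffAt.sum fun b hb => ?_)
  have hab : a ≠ b := (Finset.mem_Ioi.1 hb).ne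
  exact contDiffAt_const.div (contDiffAt_dist_apply hq hab)
    (dist_ne_zero.2 fun e => hab (hq e))

theorem contDiffAt_acceleration {n : WithTop ℕ∞} (G : ℝ) (m : Fin N → ℝ) {q : Config N}
    (hq : CollisionFree q) : ContDiffAt ℝ n (acceleration G m) q := by
  rw [contDiffAt_pi]
  intro a
  change ContDiffAt ℝ n
    (fun p : Config N => G • ∑ b, (m b / dist (p a) (p b) ^ 3) • (p b - p a)) q
  have h : ∀ b, ContDiffAt ℝ n
      (fun p : Config N => (m b / dist (p a) (p b) ^ 3) • (p b - p a)) q := fun b => by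
    by_cases hab : a = b
    · subst hab; simpa using contDiffAt_const
    · have h1 : ContDiffAt ℝ n (fun p : Config N => m b / dist (p a) (p b) ^ 3) q :=
        contDiffAt_const.div ((contDiffAt_dist_apply hq hab).pow 3)
          (pow_ne_zero 3 (dist_ne_zero.2 fun e => hab (hq e)))
      exact h1.smul ((contDiff_apply ℝ (EuclideanSpace ℝ (Fin 3)) b).contDiffAt.sub
        (contDiff_apply ℝ (EuclideanSpace ℝ (Fin 3)) a).contDiffAt)
  exact (ContDiffAt.sum fun b _ => h b).const_smul G

theorem fderiv_potential_apply (G : ℝ) (m : Fin N → ℝ) {q : Config N} (hq : CollisionFree q)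
    (w : Config N) : fderiv ℝ (potential G m) q w = potentialDeriv G m q w := by
  have hd : DifferentiableAt ℝ (potential G m) q :=
    (contDiffAt_potential (n := 1) G m hq).differentiableAt (by simp)
  have hc : HasDerivAt (fun s : ℝ => q + s • w) w 0 := by
    simpa using ((hasDerivAt_id (0 : ℝ)).smul_const w).const_add q
  have h0 : q + (0 : ℝ) • w = q := by simp
  have h1 := hasDerivAt_potential_comp G m hc (by simpa only [h0] using hq)
  have hd' : HasFDerivAt (potential G m) (fderiv ℝ (potential G m) q) (q + (0 : ℝ) • w) := by
    rw [h0]; exact hd.hasFDerivAt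
  have h2 := hd'.comp_hasDerivAt (0 : ℝ) hc
  simp only [h0] at h1
  exact h2.unique h1

theorem potentialDeriv_eq_massInner (G : ℝ) (m : Fin N → ℝ) (q w : Config N) :
    potentialDeriv G m q w = massInner m (acceleration G m q) w := by
  have h1 : ∑ a, ∑ b, m a * m b * (inner ℝ (q a - q b) (w a - w b) / dist (q a) (q b) ^ 3)
      = ∑ a, ∑ b, m a * m b * (inner ℝ (q a - q b) (w a) / dist (q a) (q b) ^ 3)
        + ∑ a, ∑ b, m a * m b * (inner ℝ (q b - q a) (w b) / dist (q a) (q b) ^ 3) := by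
    simp only [← Finset.sum_add_distrib]
    refine Finset.sum_congr rfl fun a _ => Finset.sum_congr rfl fun b _ => ?_
    rw [← neg_sub (q a) (q b), inner_neg_left, inner_sub_right]
    ring
  have h2 : ∑ a, ∑ b, m a * m b * (inner ℝ (q b - q a) (w b) / dist (q a) (q b) ^ 3)
      = ∑ a, ∑ b, m a * m b * (inner ℝ (q a - q b) (w a) / dist (q a) (q b) ^ 3) := by
    rw [Finset.sum_comm]
    refine Finset.sum_congr rfl fun a _ => Finset.sum_congr rfl fun b _ => ?_
    rw [dist_comm, mul_comm (m b)]
  have h3 : massInner m (acceleration G m q) w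
      = -G * ∑ a, ∑ b, m a * m b * (inner ℝ (q a - q b) (w a) / dist (q a) (q b) ^ 3) := by
    simp only [massInner, acceleration, Finset.mul_sum, real_inner_smul_left, sum_inner]
    refine Finset.sum_congr rfl fun a _ => Finset.sum_congr rfl fun b _ => ?_
    rw [← neg_sub (q a) (q b), inner_neg_left]
    ring
  rw [potentialDeriv, h1, h2, h3]
  ring

theorem massInner_self_nonneg {m : Fin N → ℝ} (hm : ∀ a, 0 < m a) (v : Config N) :
    0 ≤ massInner m v v :=
  Finset.sum_nonneg fun a _ => mul_nonneg (hm a).le real_inner_self_nonneg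

theorem mul_norm_sq_le_massInner {m : Fin N → ℝ} (hm : ∀ a, 0 < m a) (v : Config N) (a : Fin N) :
    m a * ‖v a‖ ^ 2 ≤ massInner m v v := by
  rw [← real_inner_self_eq_norm_sq]
  exact Finset.single_le_sum (f := fun a => m a * inner ℝ (v a) (v a))
    (fun a _ => mul_nonneg (hm a).le real_inner_self_nonneg) (Finset.mem_univ a)

theorem massInner_sub_left (m : Fin N → ℝ) (v v' w : Config N) :
    massInner m (v - v') w = massInner m v w - massInner m v' w := by
  simp [massInner, inner_sub_left, mul_sub]

theorem hasMassGradientAt_acceleration (G : ℝ) (m : Fin N → ℝ) {q : Config N}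
    (hq : CollisionFree q) : HasMassGradientAt m (potential G m) (acceleration G m q) q :=
  ⟨(contDiffAt_potential (n := 1) G m hq).differentiableAt (by simp), fun w => by
    rw [fderiv_potential_apply G m hq, potentialDeriv_eq_massInner]⟩

/-- Positive masses make the form definite. This identifies the gradient in Newton's equation with
the explicit field `acceleration`. -/
theorem HasMassGradientAt.unique {m : Fin N → ℝ} (hm : ∀ a, 0 < m a) {f : Config N → ℝ}
    {g g' q : Config N} (h : HasMassGradientAt m f g q) (h' : HasMassGradientAt m f g' q) :
    g = g' := by
  have h0 : massInner m (g - g') (g - g') = 0 := by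
    rw [massInner_sub_left, ← h.2, ← h'.2, sub_self]
  funext a
  have h1 := mul_norm_sq_le_massInner hm (g - g') a
  rw [h0] at h1
  have h2 : ‖(g - g') a‖ ^ 2 ≤ 0 := by
    by_contra hc
    exact absurd h1 (not_le.2 (mul_pos (hm a) (not_le.1 hc)))
  have h3 : ‖(g - g') a‖ = 0 := pow_eq_zero_iff two_ne_zero |>.1 (le_antisymm h2 (sq_nonneg _))
  exact sub_eq_zero.1 (norm_eq_zero.1 h3)

theorem IsSolution.hasDerivAt {G : ℝ} {m : Fin N → ℝ} {q : ℝ → Config N} {I : Set ℝ}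
    (h : IsSolution G m q I) {t : ℝ} (ht : t ∈ I) : HasDerivAt q (deriv q t) t :=
  (h.differentiableAt t ht).hasDerivAt

theorem IsSolution.hasDerivAt_deriv {G : ℝ} {m : Fin N → ℝ} (hm : ∀ a, 0 < m a)
    {q : ℝ → Config N} {I : Set ℝ} (h : IsSolution G m q I) {t : ℝ} (ht : t ∈ I) :
    HasDerivAt (deriv q) (acceleration G m (q t)) t := by
  obtain ⟨g, hg, hd⟩ := h.newton t ht
  rwa [hg.unique hm (hasMassGradientAt_acceleration G m (h.collisionFree t ht))] at hd

theorem hasDerivAt_massInner_self (m : Fin N → ℝ) {v : ℝ → Config N} {g : Config N} {t : ℝ}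
    (hv : HasDerivAt v g t) :
    HasDerivAt (fun s => massInner m (v s) (v s)) (2 * massInner m g (v t)) t := by
  have h : ∀ a, HasDerivAt (fun s => m a * inner ℝ (v s a) (v s a))
      (m a * (2 * inner ℝ (g a) (v t a))) t := fun a => by
    refine (((hasDerivAt_pi.1 hv a).inner ℝ (hasDerivAt_pi.1 hv a)).const_mul
      (m a)).congr_deriv ?_
    rw [real_inner_comm (g a)]; ring
  refine (HasDerivAt.fun_sum fun a _ => h a).congr_deriv ?_
  rw [massInner, Finset.mul_sum]
  exact Finset.sum_congr rfl fun a _ => by ring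

theorem IsSolution.energy_eq {G : ℝ} {m : Fin N → ℝ} (hm : ∀ a, 0 < m a)
    {q : ℝ → Config N} {I : Set ℝ} (h : IsSolution G m q I) {s t : ℝ} (hs : s ∈ I) (ht : t ∈ I) :
    energy G m (q s) (deriv q s) = energy G m (q t) (deriv q t) := by
  have hd : ∀ u ∈ I, HasDerivAt (fun u => energy G m (q u) (deriv q u)) 0 u := fun u hu => by
    refine (((hasDerivAt_massInner_self m (h.hasDerivAt_deriv hm hu)).div_const 2).sub
      (hasDerivAt_potential_comp G m (h.hasDerivAt hu) (h.collisionFree u hu))).congr_deriv ?_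
    rw [potentialDeriv_eq_massInner]; ring
  exact h.isOpen.is_const_of_deriv_eq_zero h.ordConnected.isPreconnected
    (fun u hu => (hd u hu).differentiableAt.differentiableWithinAt)
    (fun u hu => (hd u hu).deriv) hs ht

/-! ### Cluster decomposition and the lower bound for the gradient. -/

/-- Pigeonhole: the windows `(R₀ 3^k, R₀ 3^(k+1)]` are disjoint, and there is one more of them than
there are values `d i`, so some window is empty. -/
theorem exists_gap {ι : Type*} [Fintype ι] (d : ι → ℝ) {R₀ : ℝ} (hR₀ : 0 < R₀) :
    ∃ k ≤ Fintype.card ι, ∀ i, d i ≤ R₀ * 3 ^ k ∨ 3 * (R₀ * 3 ^ k) < d i := by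
  by_contra! H
  have H' : ∀ k : Fin (Fintype.card ι + 1), ∃ i,
      R₀ * 3 ^ (k : ℕ) < d i ∧ d i ≤ 3 * (R₀ * 3 ^ (k : ℕ)) :=
    fun k => H k (Nat.lt_succ_iff.1 k.2)
  choose f hf using H'
  obtain ⟨k, l, hkl, he⟩ := Fintype.exists_ne_map_eq_of_card_lt f (by simp)
  have key : ∀ k l : Fin (Fintype.card ι + 1), k < l → f k ≠ f l := fun k l hlt e => by
    have h1 := (hf k).2
    have h2 := (hf l).1
    rw [← e] at h2
    have h3 : R₀ * 3 ^ ((k : ℕ) + 1) ≤ R₀ * 3 ^ (l : ℕ) := by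
      gcongr
      · norm_num
      · exact hlt
    rw [pow_succ] at h3
    linarith
  rcases lt_or_gt_of_ne hkl with h | h
  · exact key k l h he
  · exact key l k h he.symm

/-- A point set with no distance in `(R, 3R]` splits into clusters; the displacement from a
base point of the cluster is bounded by `R`. -/
theorem exists_cluster_displacement {ι E : Type*} [NormedAddCommGroup E] (q : ι → E) {R : ℝ}
    (hR : 0 ≤ R) (hgap : ∀ a b, dist (q a) (q b) ≤ R ∨ 3 * R < dist (q a) (q b)) :
    ∃ w : ι → E, (∀ a, ‖w a‖ ≤ R) ∧
      ∀ a b, dist (q a) (q b) ≤ R → w a - w b = q a - q b := by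
  let s : Setoid ι :=
    { r := fun a b => dist (q a) (q b) ≤ R
      iseqv :=
        { refl := fun a => by simpa using hR
          symm := fun {a b} h => by rwa [dist_comm]
          -- Two steps of length at most `R` reach at most `2R`, and the gap excludes distances
          -- above `3R`.
          trans := fun {a b c} h1 h2 => by
            rcases hgap a c with h | h
            · exact h
            · linarith [dist_triangle (q a) (q b) (q c)] } }
  refine ⟨fun a => q a - q (Quotient.mk s a).out, fun a => ?_, fun a b hab => ?_⟩
  · have h : dist (q (Quotient.mk s a).out) (q a) ≤ R := Quotient.mk_out (s := s) a
    rwa [dist_comm, dist_eq_norm] at h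
  · have h : Quotient.mk s a = Quotient.mk s b := Quotient.sound (s := s) hab
    simp [h]

/-- A close pair contributes exactly zero, by homogeneity of degree `-1`. A far pair contributes at
most `1/(3R) + 2R/(3R)² = 5/(9R)`. -/
theorem inv_sub_inner_div_le {E : Type*} [NormedAddCommGroup E] [InnerProductSpace ℝ E]
    {x y u v : E} {R : ℝ} (hR : 0 < R) (hu : ‖u‖ ≤ R) (hv : ‖v‖ ≤ R)
    (hgap : dist x y ≤ R ∨ 3 * R < dist x y) (hclose : dist x y ≤ R → u - v = x - y) :
    (dist x y)⁻¹ - inner ℝ (x - y) (u - v) / dist x y ^ 3 ≤ R⁻¹ := by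
  rcases hgap with h | h
  · rw [hclose h, real_inner_self_eq_norm_sq, ← dist_eq_norm]
    have : (dist x y)⁻¹ - dist x y ^ 2 / dist x y ^ 3 = 0 := by
      rcases eq_or_ne (dist x y) 0 with h0 | h0
      · simp [h0]
      · field_simp; ring
    rw [this]
    exact (inv_pos.2 hR).le
  · set d := dist x y with hd
    have hd0 : 0 < d := by linarith
    have h1 : -(d * (2 * R)) ≤ inner ℝ (x - y) (u - v) := by
      have h2 := (abs_le.1 (abs_real_inner_le_norm (x - y) (u - v))).1
      have h3 : ‖u - v‖ ≤ 2 * R := (norm_sub_le u v).trans (by linarith)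
      rw [← dist_eq_norm x y] at h2
      have h4 := mul_le_mul_of_nonneg_left h3 hd0.le
      linarith
    have h5 : -(d * (2 * R)) / d ^ 3 ≤ inner ℝ (x - y) (u - v) / d ^ 3 := by gcongr
    have h6 : -(d * (2 * R)) / d ^ 3 = -(2 * R * (d⁻¹ * d⁻¹)) := by field_simp
    have h7 : d⁻¹ ≤ (3 * R)⁻¹ := inv_anti₀ (by linarith) h.le
    have h8 : d⁻¹ * d⁻¹ ≤ (3 * R)⁻¹ * (3 * R)⁻¹ :=
      mul_le_mul h7 h7 (inv_pos.2 hd0).le (by positivity)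
    have h9 : (3 * R)⁻¹ + 2 * R * ((3 * R)⁻¹ * (3 * R)⁻¹) ≤ R⁻¹ := by
      have : (3 * R)⁻¹ + 2 * R * ((3 * R)⁻¹ * (3 * R)⁻¹) = 5 / 9 * R⁻¹ := by field_simp; norm_num
      rw [this]
      linarith [inv_pos.2 hR]
    have h10 := mul_le_mul_of_nonneg_left h8 (by linarith : 0 ≤ 2 * R)
    linarith

theorem sum_sum_mul_mul_const (m : Fin N → ℝ) (c : ℝ) :
    ∑ a, ∑ b, m a * m b * c = (∑ a, m a) ^ 2 * c := by
  rw [sq, Finset.sum_mul_sum, Finset.sum_mul]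
  simp only [Finset.sum_mul]

theorem potential_add_potentialDeriv_le {G : ℝ} (hG : 0 < G) {m : Fin N → ℝ}
    (hm : ∀ a, 0 < m a) {q w : Config N} {R : ℝ} (hR : 0 < R) (hw : ∀ a, ‖w a‖ ≤ R)
    (hgap : ∀ a b, dist (q a) (q b) ≤ R ∨ 3 * R < dist (q a) (q b))
    (hclose : ∀ a b, dist (q a) (q b) ≤ R → w a - w b = q a - q b) :
    potential G m q + potentialDeriv G m q w ≤ G / 2 * ((∑ a, m a) ^ 2 * R⁻¹) := by
  have h1 : potential G m q + potentialDeriv G m q w = G / 2 * ∑ a, ∑ b, m a * m b *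
      ((dist (q a) (q b))⁻¹ - inner ℝ (q a - q b) (w a - w b) / dist (q a) (q b) ^ 3) := by
    simp only [potential_eq_half_sum, potentialDeriv, mul_sub, Finset.sum_sub_distrib,
      div_eq_mul_inv]
    ring
  rw [h1, ← sum_sum_mul_mul_const]
  refine mul_le_mul_of_nonneg_left (Finset.sum_le_sum fun a _ => Finset.sum_le_sum fun b _ => ?_)
    (by positivity)
  exact mul_le_mul_of_nonneg_left
    (inv_sub_inner_div_le hR (hw a) (hw b) (hgap a b) (hclose a b)) (mul_pos (hm a) (hm b)).le

theorem massInner_add_smul_self (m : Fin N → ℝ) (v w : Config N) (s : ℝ) :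
    massInner m (v + s • w) (v + s • w)
      = massInner m v v + 2 * s * massInner m v w + s ^ 2 * massInner m w w := by
  simp only [massInner, Finset.mul_sum, ← Finset.sum_add_distrib]
  refine Finset.sum_congr rfl fun a _ => ?_
  simp only [Pi.add_apply, Pi.smul_apply, inner_add_left, inner_add_right, real_inner_smul_left,
    real_inner_smul_right, real_inner_comm (v a) (w a)]
  ring

theorem massInner_self_le {m : Fin N → ℝ} (hm : ∀ a, 0 < m a) {w : Config N} {R : ℝ}
    (hw : ∀ a, ‖w a‖ ≤ R) : massInner m w w ≤ (∑ a, m a) * R ^ 2 := by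
  rw [massInner, Finset.sum_mul]
  refine Finset.sum_le_sum fun a _ => ?_
  rw [real_inner_self_eq_norm_sq]
  have := hw a
  have := (hm a).le
  gcongr

/-- The mass gradient of the potential is bounded away from zero on each superlevel set. -/
theorem exists_pos_le_massInner_acceleration {G : ℝ} (hG : 0 < G) {m : Fin N → ℝ}
    (hm : ∀ a, 0 < m a) {h : ℝ} (hh : 0 < h) :
    ∃ c > 0, ∀ q : Config N, h ≤ potential G m q →
      c ≤ massInner m (acceleration G m q) (acceleration G m q) := by
  set M := ∑ a, m a with hM
  have hM0 : 0 ≤ M := Finset.sum_nonneg fun a _ => (hm a).le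
  -- Chosen so that the error `G M² / (2R)` is at most `h/2` at every scale `R ≥ R₀`; the `+ 1`
  -- keeps `R₀` positive when `M = 0`.
  set R₀ := G * M ^ 2 / h + 1 with hR₀
  have hR₀0 : 0 < R₀ := by positivity
  set W := M * (R₀ * 3 ^ Fintype.card (Fin N × Fin N)) ^ 2 + 1 with hW
  have hW0 : 0 < W := by positivity
  refine ⟨h ^ 2 / (4 * W), by positivity, fun q hq => ?_⟩
  obtain ⟨k, hk, hgap⟩ := exists_gap (fun p : Fin N × Fin N => dist (q p.1) (q p.2)) hR₀0
  set R := R₀ * 3 ^ k with hR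
  have hRR : R₀ ≤ R := le_mul_of_one_le_right hR₀0.le (one_le_pow₀ (by norm_num))
  have hR0 : 0 < R := hR₀0.trans_le hRR
  obtain ⟨w, hw, hclose⟩ := exists_cluster_displacement q hR0.le fun a b => hgap (a, b)
  have h1 := potential_add_potentialDeriv_le hG hm hR0 hw (fun a b => hgap (a, b)) hclose
  have h2 : G / 2 * (M ^ 2 * R⁻¹) ≤ h / 2 := by
    have h3 : G * M ^ 2 ≤ h * R := by
      have : G * M ^ 2 = h * (R₀ - 1) := by rw [hR₀]; field_simp; ring
      rw [this]
      exact mul_le_mul_of_nonneg_left (by linarith) hh.le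
    have h4 : G * M ^ 2 * R⁻¹ ≤ h := by
      rw [← div_eq_mul_inv, div_le_iff₀ hR0]; exact h3
    linarith
  have h5 : massInner m (acceleration G m q) w ≤ -(h / 2) := by
    rw [← potentialDeriv_eq_massInner]; linarith
  have h6 : massInner m w w ≤ W := by
    refine (massInner_self_le hm hw).trans ?_
    have : R ≤ R₀ * 3 ^ Fintype.card (Fin N × Fin N) := by
      rw [hR]; gcongr; norm_num
    have h7 : M * R ^ 2 ≤ M * (R₀ * 3 ^ Fintype.card (Fin N × Fin N)) ^ 2 := by gcongr
    linarith
  -- Cauchy–Schwarz in the form `|g + s w|² ≥ 0`, with the optimal `s = h / (2W)`: it gives `|g|² ≥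
  -- s h - s² W = h² / (4W)`.
  have h7 := massInner_self_nonneg hm (acceleration G m q + (h / (2 * W)) • w)
  rw [massInner_add_smul_self] at h7
  have h8 : 2 * (h / (2 * W)) * massInner m (acceleration G m q) w
      ≤ 2 * (h / (2 * W)) * -(h / 2) := mul_le_mul_of_nonneg_left h5 (by positivity)
  have h9 : (h / (2 * W)) ^ 2 * massInner m w w ≤ (h / (2 * W)) ^ 2 * W :=
    mul_le_mul_of_nonneg_left h6 (by positivity)
  have h10 : h ^ 2 / (4 * W) = -(2 * (h / (2 * W)) * -(h / 2) + (h / (2 * W)) ^ 2 * W) := by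
    field_simp; ring
  linarith

/-! ### Separation of the bodies and the second derivative of the potential along a curve. -/

theorem exists_pos_forall_le {ι : Type*} [Finite ι] (f : ι → ℝ) (hf : ∀ i, 0 < f i) :
    ∃ δ > 0, ∀ i, δ ≤ f i := by
  cases isEmpty_or_nonempty ι
  · exact ⟨1, one_pos, fun i => isEmptyElim i⟩
  · obtain ⟨i, hi⟩ := Finite.exists_min f
    exact ⟨f i, hf i, hi⟩

/-- A bound on the potential keeps the bodies apart. -/
theorem exists_pos_le_dist {G : ℝ} (hG : 0 < G) {m : Fin N → ℝ} (hm : ∀ a, 0 < m a) {B : ℝ}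
    (hB : 0 < B) : ∃ δ > 0, ∀ q : Config N, CollisionFree q → potential G m q ≤ B →
      ∀ a b, a ≠ b → δ ≤ dist (q a) (q b) := by
  obtain ⟨δ, hδ, hle⟩ := exists_pos_forall_le
    (fun p : Fin N × Fin N => G / 2 * (m p.1 * m p.2) / B) fun p =>
      div_pos (mul_pos (half_pos hG) (mul_pos (hm _) (hm _))) hB
  refine ⟨δ, hδ, fun q hq hU a b hab => (hle (a, b)).trans ?_⟩
  have hd : 0 < dist (q a) (q b) := dist_pos.2 fun e => hab (hq e)
  have h0 : ∀ a b, 0 ≤ m a * m b / dist (q a) (q b) := fun a b =>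
    div_nonneg (mul_pos (hm a) (hm b)).le dist_nonneg
  have h1 : m a * m b / dist (q a) (q b) ≤ ∑ a, ∑ b, m a * m b / dist (q a) (q b) :=
    (Finset.single_le_sum (f := fun b => m a * m b / dist (q a) (q b)) (fun b _ => h0 a b)
      (Finset.mem_univ b)).trans
    (Finset.single_le_sum (f := fun a => ∑ b, m a * m b / dist (q a) (q b))
      (fun a _ => Finset.sum_nonneg fun b _ => h0 a b) (Finset.mem_univ a))
  have h2 := (mul_le_mul_of_nonneg_left h1 (half_pos hG).le).trans
    ((potential_eq_half_sum G m q).symm.le.trans hU)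
  rw [div_le_iff₀ hB]
  rw [← mul_div_assoc, div_le_iff₀ hd] at h2
  linarith

theorem norm_acceleration_le {G : ℝ} (hG : 0 < G) {m : Fin N → ℝ} (hm : ∀ a, 0 < m a)
    {q : Config N} {δ : ℝ} (hδ : 0 < δ) (hq : ∀ a b, a ≠ b → δ ≤ dist (q a) (q b)) :
    ‖acceleration G m q‖ ≤ G * ((∑ a, m a) / δ ^ 2) := by
  have hM0 : 0 ≤ ∑ a, m a := Finset.sum_nonneg fun a _ => (hm a).le
  refine (pi_norm_le_iff_of_nonneg (by positivity)).2 fun a => ?_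
  rw [acceleration, norm_smul, Real.norm_of_nonneg hG.le]
  refine mul_le_mul_of_nonneg_left ?_ hG.le
  rw [Finset.sum_div]
  refine norm_sum_le_of_le _ fun b _ => ?_
  by_cases hab : a = b
  · subst hab
    simpa using div_nonneg (hm a).le (sq_nonneg δ)
  · have h1 := hq a b hab
    have hd : 0 < dist (q a) (q b) := hδ.trans_le h1
    rw [norm_smul, ← dist_eq_norm, dist_comm (q b), Real.norm_of_nonneg
      (div_nonneg (hm b).le (by positivity))]
    have : m b / dist (q a) (q b) ^ 3 * dist (q a) (q b) = m b / dist (q a) (q b) ^ 2 := by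
      field_simp
    rw [this]
    have := (hm b).le
    gcongr

/-- The second derivative of the potential along a curve. -/
theorem exists_hasDerivAt_potentialDeriv {G : ℝ} (hG : 0 < G) {m : Fin N → ℝ}
    (hm : ∀ a, 0 < m a) {q v : ℝ → Config N} {g : Config N} {t δ : ℝ}
    (hq : HasDerivAt q (v t) t) (hv : HasDerivAt v g t) (hδ : 0 < δ)
    (hsep : ∀ a b, a ≠ b → δ ≤ dist (q t a) (q t b)) :
    ∃ D, HasDerivAt (fun s => potentialDeriv G m (q s) (v s)) D t ∧
      potentialDeriv G m (q t) g - 2 * G * (∑ a, m a) / δ ^ 3 * massInner m (v t) (v t) ≤ D := by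
  have hpair : ∀ a b : Fin N, ∃ D,
      HasDerivAt (fun s => inner ℝ (q s a - q s b) (v s a - v s b) / dist (q s a) (q s b) ^ 3)
        D t ∧ D ≤ inner ℝ (q t a - q t b) (g a - g b) / dist (q t a) (q t b) ^ 3 +
          (2 * ‖v t a‖ ^ 2 + 2 * ‖v t b‖ ^ 2) / δ ^ 3 := by
    intro a b
    by_cases hab : a = b
    · subst hab
      refine ⟨0, by simpa using hasDerivAt_const t (0 : ℝ), ?_⟩
      simp only [sub_self, inner_zero_left, zero_div, zero_add]
      positivity
    · have h1 := hsep a b hab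
      have hd : 0 < dist (q t a) (q t b) := hδ.trans_le h1
      have hn := ((hasDerivAt_pi.1 hq a).sub (hasDerivAt_pi.1 hq b)).inner ℝ
        ((hasDerivAt_pi.1 hv a).sub (hasDerivAt_pi.1 hv b))
      have hdd := (hasDerivAt_dist_comp (hasDerivAt_pi.1 hq a) (hasDerivAt_pi.1 hq b)
        (dist_pos.1 hd)).pow 3
      refine ⟨_, hn.div hdd (pow_pos hd 3).ne', ?_⟩
      simp only [Pi.sub_apply]
      rw [real_inner_self_eq_norm_sq]
      set d := dist (q t a) (q t b)
      set x := inner ℝ (q t a - q t b) (g a - g b)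
      set p := inner ℝ (q t a - q t b) (v t a - v t b)
      have h2 : ‖v t a - v t b‖ ^ 2 ≤ 2 * ‖v t a‖ ^ 2 + 2 * ‖v t b‖ ^ 2 := by
        have h3 := norm_sub_le (v t a) (v t b)
        have h4 : ‖v t a - v t b‖ ^ 2 ≤ (‖v t a‖ + ‖v t b‖) ^ 2 := by gcongr
        nlinarith [sq_nonneg (‖v t a‖ - ‖v t b‖)]
      have h5 : ‖v t a - v t b‖ ^ 2 / d ^ 3 ≤ (2 * ‖v t a‖ ^ 2 + 2 * ‖v t b‖ ^ 2) / δ ^ 3 := by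
        gcongr
      have h6 : ((x + ‖v t a - v t b‖ ^ 2) * d ^ 3 - p * (((3 : ℕ) : ℝ) * d ^ (3 - 1) * (p / d)))
          / (d ^ 3) ^ 2 = x / d ^ 3 + ‖v t a - v t b‖ ^ 2 / d ^ 3 - 3 * p ^ 2 / d ^ 5 := by
        push_cast
        field_simp
      -- This term can be dropped: the factor `-(G / 2)` turns upper bounds for the pairs into a
      -- lower bound for the total.
      have h7 : 0 ≤ 3 * p ^ 2 / d ^ 5 := by positivity
      rw [h6]
      linarith
  choose D hD hle using hpair
  refine ⟨-(G / 2) * ∑ a, ∑ b, m a * m b * D a b, ?_, ?_⟩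
  · exact (HasDerivAt.fun_sum fun a _ => HasDerivAt.fun_sum fun b _ =>
      (hD a b).const_mul (m a * m b)).const_mul (-(G / 2))
  · have h1 : ∑ a, ∑ b, m a * m b * D a b ≤ ∑ a, ∑ b, m a * m b *
        (inner ℝ (q t a - q t b) (g a - g b) / dist (q t a) (q t b) ^ 3 +
          (2 * ‖v t a‖ ^ 2 + 2 * ‖v t b‖ ^ 2) / δ ^ 3) :=
      Finset.sum_le_sum fun a _ => Finset.sum_le_sum fun b _ =>
        mul_le_mul_of_nonneg_left (hle a b) (mul_pos (hm a) (hm b)).le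
    have h2 : ∑ a, ∑ b, m a * m b * ((2 * ‖v t a‖ ^ 2 + 2 * ‖v t b‖ ^ 2) / δ ^ 3)
        = 4 * (∑ a, m a) / δ ^ 3 * massInner m (v t) (v t) := by
      have h3 : ∀ a b, m a * m b * ((2 * ‖v t a‖ ^ 2 + 2 * ‖v t b‖ ^ 2) / δ ^ 3)
          = 2 / δ ^ 3 * (m a * ‖v t a‖ ^ 2 * m b) + 2 / δ ^ 3 * (m a * (m b * ‖v t b‖ ^ 2)) :=
        fun a b => by ring
      simp only [h3, Finset.sum_add_distrib, ← Finset.mul_sum, ← Finset.sum_mul, massInner,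
        real_inner_self_eq_norm_sq]
      ring
    simp only [mul_add (_ * _ : ℝ), Finset.sum_add_distrib, h2] at h1
    rw [potentialDeriv]
    have h4 := mul_le_mul_of_nonneg_left h1 (half_pos hG).le
    rw [mul_add] at h4
    have h5 : G / 2 * (4 * (∑ a, m a) / δ ^ 3 * massInner m (v t) (v t))
      = 2 * G * (∑ a, m a) / δ ^ 3 * massInner m (v t) (v t) := by ring
    linarith

end NBody
end

/-! ### Continuation of integral curves past a finite end point. -/

noncomputable section

open Set Filter Topology

/-- A bounded integral curve whose closure stays in an open set on which the vector field is `C¹`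
can be continued past a finite end point. -/
theorem exists_integralCurve_extension {E : Type*} [NormedAddCommGroup E] [NormedSpace ℝ E]
    [FiniteDimensional ℝ E] {F : E → E} {Ω : Set E} (hΩ : IsOpen Ω)
    (hF : ∀ z ∈ Ω, ContDiffAt ℝ 1 F z) {y : ℝ → E} {a b K : ℝ} (hab : a < b)
    (hy : ∀ t ∈ Ioo a b, HasDerivAt y (F (y t)) t) (hK : ∀ t ∈ Ioo a b, ‖F (y t)‖ ≤ K)
    (hcl : closure (y '' Ioo a b) ⊆ Ω) :
    ∃ z : ℝ → E, ∃ ε > 0, (∀ t < b, z t = y t) ∧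
      ∀ t ∈ Ico b (b + ε), z t ∈ Ω ∧ HasDerivAt z (F (z t)) t := by
  have := FiniteDimensional.complete ℝ E
  have hlip : LipschitzOnWith K.toNNReal y (Ioo a b) :=
    (convex_Ioo a b).lipschitzOnWith_of_nnnorm_hasDerivWithin_le
      (fun t ht => (hy t ht).hasDerivWithinAt)
      (fun t ht => by
        rw [← NNReal.coe_le_coe, coe_nnnorm]
        exact (hK t ht).trans (Real.le_coe_toNNReal K))
  -- A globally Lipschitz extension of `y` supplies the limit at `b`, from which a local solution
  -- `α` is started.
  obtain ⟨g, hg, hgy⟩ := hlip.extend_finite_dimension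
  have hIoo : Ioo a b ∈ 𝓝[<] b := Ioo_mem_nhdsLT hab
  have hlim : Tendsto y (𝓝[<] b) (𝓝 (g b)) := by
    refine (hg.continuous.continuousAt.tendsto.mono_left nhdsWithin_le_nhds).congr' ?_
    filter_upwards [hIoo] with t ht using (hgy ht).symm
  have hmem : g b ∈ Ω := hcl <| mem_closure_of_tendsto hlim <| by
    filter_upwards [hIoo] with t ht using mem_image_of_mem y ht
  obtain ⟨α, hα0, ε, hε, hα⟩ :=
    (hF _ hmem).exists_forall_mem_closedBall_exists_eq_forall_mem_Ioo_hasDerivAt₀ b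
  have hαc : ContinuousAt α b := (hα b ⟨by linarith, by linarith⟩).continuousAt
  obtain ⟨η, hη, hηΩ⟩ := Metric.mem_nhds_iff.1
    (hαc.preimage_mem_nhds (hΩ.mem_nhds (by rwa [hα0])))
  let z : ℝ → E := fun t => if t < b then y t else α t
  have hzl : ∀ t < b, z t = y t := fun t ht => if_pos ht
  have hzr : ∀ t, b ≤ t → z t = α t := fun t ht => if_neg ht.not_gt
  have hzyd : ∀ t ∈ Ioo a b, HasDerivAt z (F (y t)) t := fun t ht =>
    (hy t ht).congr_of_eventuallyEq (by filter_upwards [Iio_mem_nhds ht.2] with s hs using hzl s hs)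
  refine ⟨z, min ε η, lt_min hε hη, hzl, fun t ht => ?_⟩
  have htε : t < b + ε := ht.2.trans_le (by linarith [min_le_left ε η])
  have htη : t < b + η := ht.2.trans_le (by linarith [min_le_right ε η])
  have hαt := hα t ⟨by linarith [ht.1], htε⟩
  rw [hzr t ht.1]
  refine ⟨hηΩ ?_, ?_⟩
  · rw [Metric.mem_ball, Real.dist_eq, abs_lt]
    constructor <;> linarith [ht.1]
  · rcases ht.1.eq_or_lt with rfl | hlt
    · have h1 : HasDerivWithinAt z (F (α b)) (Ici b) b :=
        hαt.hasDerivWithinAt.congr (fun s hs => hzr s hs) (hzr b le_rfl)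
      -- At the junction the left derivative is the limit of the derivatives of `y`; it matches the
      -- right derivative from `α`.
      have h2 : HasDerivWithinAt z (F (α b)) (Iic b) b := by
        refine hasDerivWithinAt_Iic_of_tendsto_deriv (s := Ioo a b)
          (fun s hs => (hzyd s hs).differentiableAt.differentiableWithinAt) ?_ hIoo ?_
        · rw [ContinuousWithinAt, hzr b le_rfl, hα0]
          refine (hlim.mono_left (nhdsWithin_mono _ Ioo_subset_Iio_self)).congr' ?_
          filter_upwards [self_mem_nhdsWithin] with s hs using (hzl s hs.2).symm
        · rw [hα0]
          refine ((hF _ hmem).continuousAt.tendsto.comp hlim).congr' ?_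
          filter_upwards [hIoo] with s hs using (hzyd s hs).deriv.symm
      simpa [hasDerivWithinAt_univ] using h2.union h1
    · exact hαt.congr_of_eventuallyEq
        (by filter_upwards [Ioi_mem_nhds hlt] with s hs using hzr s hs.le)

/-! ### Convex functions of one variable: time spent below a level and first crossing. -/

/-- Since `f - β t² / 2` is convex, the midpoint value of `f` lies at least `β (y - x)² / 8` below
the mean of its end values; the former is nonnegative, the latter at most `L`. -/
theorem mul_sq_le_of_le_deriv2 {f f' f'' : ℝ → ℝ} {x y β L : ℝ} (hxy : x ≤ y)
    (hf : ∀ t ∈ Icc x y, HasDerivAt f (f' t) t) (hf' : ∀ t ∈ Icc x y, HasDerivAt f' (f'' t) t)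
    (hβ : ∀ t ∈ Icc x y, β ≤ f'' t) (h0 : ∀ t ∈ Icc x y, 0 ≤ f t)
    (hL : ∀ t ∈ Icc x y, f t ≤ L) : β * (y - x) ^ 2 ≤ 8 * L := by
  have hconv : ConvexOn ℝ (Icc x y) fun t => f t - β / 2 * t ^ 2 := by
    refine convexOn_of_hasDerivWithinAt2_nonneg (f' := fun t => f' t - β * t)
      (f'' := fun t => f'' t - β) (convex_Icc x y) (fun t ht => ?_) (fun t ht => ?_)
      (fun t ht => ?_) (fun t ht => ?_)
    · exact ((hf t ht).continuousAt.sub (by fun_prop)).continuousWithinAt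
    · refine (((hf t (interior_subset ht)).sub
        (((hasDerivAt_id t).pow 2).const_mul (β / 2))).congr_deriv ?_).hasDerivWithinAt
      simp; ring
    · refine (((hf' t (interior_subset ht)).sub
        ((hasDerivAt_id t).const_mul β)).congr_deriv ?_).hasDerivWithinAt
      simp
    · exact sub_nonneg.2 (hβ t (interior_subset ht))
  have hx := left_mem_Icc.2 hxy
  have hy := right_mem_Icc.2 hxy
  have h1 := hconv.2 hx hy (by norm_num : (0 : ℝ) ≤ 1 / 2) (by norm_num : (0 : ℝ) ≤ 1 / 2)
    (by norm_num)
  have h2 := h0 ((1 / 2 : ℝ) • x + (1 / 2 : ℝ) • y)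
    (convex_Icc x y hx hy (by norm_num) (by norm_num) (by norm_num))
  simp only [smul_eq_mul] at h1 h2
  have h3 := hL x hx
  have h4 := hL y hy
  nlinarith

/-- Convexity is assumed only where `f ≤ L`, which covers the time up to the first hit. The mean
value theorem gives a positive slope before the hit, and monotonicity of `f'` carries it to the hit.
-/
theorem exists_first_crossing {f f' f'' : ℝ → ℝ} {t₀ t L : ℝ} (ht : t₀ ≤ t)
    (hf : ∀ s ∈ Icc t₀ t, HasDerivAt f (f' s) s)
    (hf' : ∀ s ∈ Icc t₀ t, f s ≤ L → HasDerivAt f' (f'' s) s)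
    (hpos : ∀ s ∈ Icc t₀ t, f s ≤ L → 0 ≤ f'' s) (h0 : f t₀ < L) (h1 : L ≤ f t) :
    ∃ t₂ ∈ Icc t₀ t, t₀ < t₂ ∧ f t₂ = L ∧ (∀ s ∈ Ico t₀ t₂, f s < L) ∧ 0 < f' t₂ := by
  have hc : ContinuousOn f (Icc t₀ t) := fun s hs => (hf s hs).continuousAt.continuousWithinAt
  set S := Icc t₀ t ∩ f ⁻¹' Ici L with hS
  have hScl : IsClosed S := hc.preimage_isClosed_of_isClosed isClosed_Icc isClosed_Ici
  have hSbdd : BddBelow S := ⟨t₀, fun s hs => hs.1.1⟩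
  have hmem : sInf S ∈ S := hScl.csInf_mem ⟨t, right_mem_Icc.2 ht, h1⟩ hSbdd
  set t₂ := sInf S
  have hlt : t₀ < t₂ := hmem.1.1.lt_of_ne fun e => by
    have : L ≤ f t₂ := hmem.2
    rw [← e] at this
    exact absurd h0 this.not_gt
  have hsub : Icc t₀ t₂ ⊆ Icc t₀ t := Icc_subset_Icc_right hmem.1.2
  have hbelow : ∀ s ∈ Ico t₀ t₂, f s < L := fun s hs => by
    by_contra hcon
    exact absurd (csInf_le hSbdd ⟨hsub ⟨hs.1, hs.2.le⟩, not_lt.1 hcon⟩) hs.2.not_ge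
  have heq : f t₂ = L := by
    obtain ⟨s, hs, hsL⟩ := intermediate_value_Icc hlt.le (hc.mono hsub) ⟨h0.le, hmem.2⟩
    rcases hs.2.eq_or_lt with rfl | h
    · exact hsL
    · exact absurd hsL (hbelow s ⟨hs.1, h⟩).ne
  refine ⟨t₂, hmem.1, hlt, heq, hbelow, ?_⟩
  obtain ⟨ξ, hξ, hξd⟩ := exists_hasDerivAt_eq_slope f f' hlt (hc.mono hsub)
    fun s hs => hf s (hsub ⟨hs.1.le, hs.2.le⟩)
  have hξ0 : 0 < f' ξ := by
    rw [hξd, heq]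
    exact div_pos (sub_pos.2 h0) (sub_pos.2 hlt)
  have hle : ∀ s ∈ Icc t₀ t₂, f s ≤ L := fun s hs => by
    rcases hs.2.eq_or_lt with rfl | h
    · exact heq.le
    · exact (hbelow s ⟨hs.1, h⟩).le
  have hd : ∀ s ∈ Icc t₀ t₂, HasDerivAt f' (f'' s) s := fun s hs => hf' s (hsub hs) (hle s hs)
  have hmono : MonotoneOn f' (Icc t₀ t₂) := by
    refine monotoneOn_of_deriv_nonneg (convex_Icc _ _)
      (fun s hs => (hd s hs).continuousAt.continuousWithinAt)
      (fun s hs => (hd s (interior_subset hs)).differentiableAt.differentiableWithinAt)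
      fun s hs => ?_
    have hs' := interior_subset hs
    rw [(hd s hs').deriv]
    exact hpos s (hsub hs') (hle s hs')
  exact hξ0.trans_le (hmono ⟨hξ.1.le, hξ.2.le⟩ (right_mem_Icc.2 hlt.le) hξ.2.le)

/-! ### Time reversal and continuation of maximal solutions. -/

namespace NBody

variable {N : ℕ}

theorem IsSolution.of_hasDerivAt {G : ℝ} {m : Fin N → ℝ} {q v : ℝ → Config N} {I : Set ℝ}
    (hI : IsOpen I) (hI' : I.OrdConnected) (hq : ∀ t ∈ I, CollisionFree (q t))
    (hv : ∀ t ∈ I, HasDerivAt q (v t) t) (ha : ∀ t ∈ I, HasDerivAt v (acceleration G m (q t)) t) :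
    IsSolution G m q I where
  isOpen := hI
  ordConnected := hI'
  collisionFree := hq
  differentiableAt t ht := (hv t ht).differentiableAt
  newton t ht := ⟨_, hasMassGradientAt_acceleration G m (hq t ht),
    (ha t ht).congr_of_eventuallyEq (by
      filter_upwards [hI.mem_nhds ht] with s hs using (hv s hs).deriv)⟩

theorem IsSolution.comp_neg {G : ℝ} {m : Fin N → ℝ} (hm : ∀ a, 0 < m a) {q : ℝ → Config N}
    {I : Set ℝ} (h : IsSolution G m q I) :
    IsSolution G m (fun t => q (-t)) (Neg.neg ⁻¹' I) := by
  refine .of_hasDerivAt (v := fun t => -deriv q (-t)) (h.isOpen.preimage continuous_neg) ?_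
    (fun t ht => h.collisionFree _ ht) (fun t ht => ?_) (fun t ht => ?_)
  · exact h.ordConnected.preimage_anti fun _ _ => neg_le_neg
  · exact ((h.hasDerivAt ht).scomp t (hasDerivAt_neg t)).congr_deriv (by simp)
  · exact ((h.hasDerivAt_deriv hm ht).scomp t (hasDerivAt_neg t)).neg.congr_deriv (by simp)

theorem IsMaximalSolution.comp_neg {G : ℝ} {m : Fin N → ℝ} (hm : ∀ a, 0 < m a)
    {q : ℝ → Config N} {I : Set ℝ} (h : IsMaximalSolution G m q I) :
    IsMaximalSolution G m (fun t => q (-t)) (Neg.neg ⁻¹' I) := by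
  refine ⟨h.1.comp_neg hm, fun q' I' hq' hI hE => ?_⟩
  have h1 := h.2 (fun t => q' (-t)) (Neg.neg ⁻¹' I') (hq'.comp_neg hm)
    (fun t ht => hI (by simpa using ht)) (fun t ht => by
      simpa using hE (x := -t) (by simpa using ht))
  rw [← h1, ← preimage_comp]
  simp

theorem isOpen_setOf_collisionFree : IsOpen {q : Config N | CollisionFree q} := by
  have : {q : Config N | CollisionFree q} = ⋂ a, ⋂ b, {q | a = b ∨ q a ≠ q b} := by
    ext q
    simp only [CollisionFree, Function.Injective, mem_ofPred_eq, mem_iInter]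
    exact forall_congr' fun a => forall_congr' fun b => by tauto
  rw [this]
  refine isOpen_iInter_of_finite fun a => isOpen_iInter_of_finite fun b => ?_
  by_cases hab : a = b
  · simp [hab]
  · simpa [hab] using isOpen_ne_fun (continuous_apply a) (continuous_apply b)

theorem norm_le_sqrt_massInner {m : Fin N → ℝ} {μ : ℝ} (hμ : 0 < μ) (hm : ∀ a, μ ≤ m a)
    (v : Config N) : ‖v‖ ≤ √(massInner m v v / μ) := by
  refine (pi_norm_le_iff_of_nonneg (Real.sqrt_nonneg _)).2 fun a => ?_
  refine Real.le_sqrt_of_sq_le ?_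
  rw [le_div_iff₀ hμ, mul_comm]
  exact (mul_le_mul_of_nonneg_right (hm a) (sq_nonneg _)).trans
    (mul_norm_sq_le_massInner (fun a => hμ.trans_le (hm a)) v a)

/-- A maximal solution along which the potential stays bounded exists for all later times. -/
theorem IsMaximalSolution.Ici_subset {G : ℝ} (hG : 0 < G) {m : Fin N → ℝ} (hm : ∀ a, 0 < m a)
    {q : ℝ → Config N} {I : Set ℝ} (h : IsMaximalSolution G m q I) {t₀ B : ℝ} (ht₀ : t₀ ∈ I)
    (hB : 0 < B) (hU : ∀ t ∈ I, t₀ ≤ t → potential G m (q t) ≤ B) : Ici t₀ ⊆ I := by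
  by_contra hcon
  obtain ⟨s, hs, hsI⟩ := not_subset.1 hcon
  have hcl : IsClosed (Ici t₀ \ I) := isClosed_Ici.sdiff h.1.isOpen
  have hbdd : BddBelow (Ici t₀ \ I) := ⟨t₀, fun s hs => hs.1⟩
  have hbm := hcl.csInf_mem ⟨s, hs, hsI⟩ hbdd
  set b := sInf (Ici t₀ \ I)
  have htb : t₀ < b := lt_of_le_of_ne hbm.1 fun e => hbm.2 (e ▸ ht₀)
  have hIco : Ico t₀ b ⊆ I := fun t ht => by
    by_contra htI
    exact absurd (csInf_le hbdd ⟨ht.1, htI⟩) ht.2.not_ge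
  have hIb : ∀ t ∈ I, t < b := fun t ht => by
    by_contra hbt
    exact hbm.2 (h.1.ordConnected.out ht₀ ht ⟨hbm.1, not_lt.1 hbt⟩)
  obtain ⟨δ, hδ, hsep⟩ := exists_pos_le_dist hG hm hB
  obtain ⟨μ, hμ, hμm⟩ := exists_pos_forall_le m hm
  have hsepI : ∀ t ∈ I, t₀ ≤ t → ∀ a c, a ≠ c → δ ≤ dist (q t a) (q t c) := fun t ht h0 =>
    hsep _ (h.1.collisionFree t ht) (hU t ht h0)
  let F : Config N × Config N → Config N × Config N := fun p => (p.2, acceleration G m p.1)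
  let y : ℝ → Config N × Config N := fun t => (q t, deriv q t)
  have hyd : ∀ t ∈ I, HasDerivAt y (F (y t)) t := fun t ht =>
    (h.1.hasDerivAt ht).prodMk (h.1.hasDerivAt_deriv hm ht)
  obtain ⟨z, ε, hε, hzl, hzr⟩ := exists_integralCurve_extension (F := F) (y := y)
    -- The first bound is for the velocity, by energy conservation; the second is for the
    -- acceleration, by separation of the bodies.
    (Ω := {p | CollisionFree p.1}) (K := max
      (√(2 * (energy G m (q t₀) (deriv q t₀) + B) / μ)) (G * ((∑ a, m a) / δ ^ 2)))
    (isOpen_setOf_collisionFree.preimage continuous_fst)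
    (fun p hp => contDiffAt_snd.prodMk ((contDiffAt_acceleration G m hp).comp p contDiffAt_fst))
    htb (fun t ht => hyd t (hIco ⟨ht.1.le, ht.2⟩))
    (fun t ht => by
      have htI := hIco ⟨ht.1.le, ht.2⟩
      refine max_le_max ((norm_le_sqrt_massInner hμ hμm _).trans ?_)
        (norm_acceleration_le hG hm hδ (hsepI t htI ht.1.le))
      have h1 := h.1.energy_eq hm htI ht₀
      have h2 := hU t htI ht.1.le
      have h3 : massInner m (deriv q t) (deriv q t)
          ≤ 2 * (energy G m (q t₀) (deriv q t₀) + B) := by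
        rw [← h1, energy]; linarith
      exact Real.sqrt_le_sqrt (div_le_div_of_nonneg_right h3 hμ.le))
    (by
      -- Separation by `δ` is a closed condition, so limit points of the orbit are still
      -- collision-free.
      have hC : IsClosed {p : Config N × Config N | ∀ a c, a ≠ c → δ ≤ dist (p.1 a) (p.1 c)} := by
        simp only [ofPred_forall]
        refine isClosed_iInter fun a => isClosed_iInter fun c => isClosed_iInter fun _ => ?_
        exact isClosed_le continuous_const (by fun_prop)
      refine (closure_minimal ?_ hC).trans fun p hp a c hac => ?_
      · rintro _ ⟨t, ht, rfl⟩
        exact hsepI t (hIco ⟨ht.1.le, ht.2⟩) ht.1.le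
      · by_contra hne
        have := hp a c hne
        rw [hac, dist_self] at this
        linarith)
  have hzI : ∀ t ∈ I ∪ Ioo t₀ (b + ε), CollisionFree (z t).1 ∧ HasDerivAt z (F (z t)) t := by
    intro t ht
    have hcase : t ∈ I ∨ t ∈ Ico b (b + ε) := by
      rcases ht with ht | ht
      · exact .inl ht
      · rcases lt_or_ge t b with h1 | h1
        · exact .inl (hIco ⟨ht.1.le, h1⟩)
        · exact .inr ⟨h1, ht.2⟩
    rcases hcase with ht | ht
    · rw [hzl t (hIb t ht)]
      exact ⟨h.1.collisionFree t ht, (hyd t ht).congr_of_eventuallyEq (by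
        filter_upwards [Iio_mem_nhds (hIb t ht)] with s hs using hzl s hs)⟩
    · exact hzr t ht
  have hsol : IsSolution G m (fun t => (z t).1) (I ∪ Ioo t₀ (b + ε)) := by
    refine .of_hasDerivAt (v := fun t => (z t).2) (h.1.isOpen.union isOpen_Ioo) ?_
      (fun t ht => (hzI t ht).1) (fun t ht => (hzI t ht).2.fst) (fun t ht => (hzI t ht).2.snd)
    rw [← isPreconnected_iff_ordConnected]
    refine IsPreconnected.union' ?_ h.1.ordConnected.isPreconnected isPreconnected_Ioo
    exact ⟨(t₀ + b) / 2, hIco ⟨by linarith, by linarith⟩, by linarith, by linarith⟩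
  have heq := h.2 _ _ hsol subset_union_left fun t ht => by rw [hzl t (hIb t ht)]
  exact hbm.2 (heq ▸ Or.inr ⟨htb, by linarith⟩)

end NBody
end

/-! ### Passage through the collar of the Hill boundary. -/

noncomputable section

open Set

namespace NBody

variable {N : ℕ}

/-- Near the Hill boundary the potential is uniformly convex along solutions of energy `-h`. -/
theorem exists_convexity_constants {G : ℝ} (hG : 0 < G) {m : Fin N → ℝ}
    (hm : ∀ a, 0 < m a) {h : ℝ} (hh : 0 < h) :
    ∃ η > 0, ∃ β > 0, ∀ (q : ℝ → Config N) (I : Set ℝ), IsSolution G m q I →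
      ∀ t ∈ I, energy G m (q t) (deriv q t) = -h → potential G m (q t) ≤ h + η →
        ∃ D ≥ β, HasDerivAt (fun s => potentialDeriv G m (q s) (deriv q s)) D t := by
  obtain ⟨c, hc, hgrad⟩ := exists_pos_le_massInner_acceleration hG hm hh
  obtain ⟨δ, hδ, hsep⟩ := exists_pos_le_dist hG hm (mul_pos two_pos hh)
  set A := 2 * G * (∑ a, m a) / δ ^ 3 with hA
  have hA0 : 0 ≤ A := by
    have : 0 ≤ ∑ a, m a := Finset.sum_nonneg fun a _ => (hm a).le
    positivity
  -- The bound `h` keeps `U ≤ 2h`, where `δ` applies. The other gives `|q'|² = 2(U - h) ≤ c / (2(A +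
  -- 1))`, so the Hessian term costs at most `c/2`.
  refine ⟨min h (c / (4 * (A + 1))), lt_min hh (by positivity), c / 2, by positivity,
    fun q I hq t ht hE hU => ?_⟩
  have hU1 : potential G m (q t) ≤ 2 * h :=
    hU.trans (by linarith [min_le_left h (c / (4 * (A + 1)))])
  have hU2 : potential G m (q t) ≤ h + c / (4 * (A + 1)) :=
    hU.trans (by linarith [min_le_right h (c / (4 * (A + 1)))])
  obtain ⟨D, hD, hle⟩ := exists_hasDerivAt_potentialDeriv hG hm (hq.hasDerivAt ht)
    (hq.hasDerivAt_deriv hm ht) hδ (hsep _ (hq.collisionFree t ht) hU1)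
  refine ⟨D, ?_, hD⟩
  have hv := massInner_self_nonneg hm (deriv q t)
  rw [energy] at hE
  rw [potentialDeriv_eq_massInner, ← hA] at hle
  have h1 := hgrad (q t) (by linarith)
  have h2 : massInner m (deriv q t) (deriv q t) ≤ c / (2 * (A + 1)) := by
    have : c / (2 * (A + 1)) = 2 * (c / (4 * (A + 1))) := by field_simp; norm_num
    linarith
  have h3 : A * massInner m (deriv q t) (deriv q t) ≤ c / 2 := by
    have h4 : (A + 1) * (c / (2 * (A + 1))) = c / 2 := by field_simp
    have h5 := mul_le_mul_of_nonneg_left h2 (by linarith : 0 ≤ A + 1)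
    linarith
  linarith

theorem IsSolution.le_potential {G : ℝ} {m : Fin N → ℝ} (hm : ∀ a, 0 < m a)
    {q : ℝ → Config N} {I : Set ℝ} (hq : IsSolution G m q I) {h t₀ t : ℝ} (ht₀ : t₀ ∈ I)
    (ht : t ∈ I) (hE : energy G m (q t₀) (deriv q t₀) = -h) : h ≤ potential G m (q t) := by
  rw [hq.energy_eq hm ht₀ ht, energy] at hE
  linarith [massInner_self_nonneg hm (deriv q t)]

/-- The time that a solution of energy `-h` spends continuously in a thin collar. -/
theorem IsSolution.mul_sq_le {G : ℝ} {m : Fin N → ℝ} (hm : ∀ a, 0 < m a) {h β L : ℝ}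
    {q : ℝ → Config N} {I : Set ℝ} (hq : IsSolution G m q I) {x y t₀ : ℝ} (hxy : x ≤ y)
    (hI : Icc x y ⊆ I) (ht₀ : t₀ ∈ I) (hE : energy G m (q t₀) (deriv q t₀) = -h)
    (hβ : ∀ t ∈ I, potential G m (q t) ≤ h + L →
      ∃ D ≥ β, HasDerivAt (fun s => potentialDeriv G m (q s) (deriv q s)) D t)
    (hL : ∀ t ∈ Icc x y, potential G m (q t) ≤ h + L) : β * (y - x) ^ 2 ≤ 8 * L := by
  refine mul_sq_le_of_le_deriv2 (f := fun t => potential G m (q t) - h)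
    (f' := fun t => potentialDeriv G m (q t) (deriv q t))
    (f'' := deriv fun t => potentialDeriv G m (q t) (deriv q t)) hxy
    (fun t ht => ?_) (fun t ht => ?_) (fun t ht => ?_) (fun t ht => ?_) (fun t ht => ?_)
  · exact (hasDerivAt_potential_comp G m (hq.hasDerivAt (hI ht))
      (hq.collisionFree t (hI ht))).sub_const h
  · obtain ⟨D, -, hD⟩ := hβ t (hI ht) (hL t ht)
    exact hD.differentiableAt.hasDerivAt
  · obtain ⟨D, hDβ, hD⟩ := hβ t (hI ht) (hL t ht)
    rw [hD.deriv]
    exact hDβ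
  · exact sub_nonneg.2 (hq.le_potential hm ht₀ (hI ht) hE)
  · linarith [hL t ht]

/-- A solution of energy `-h` leaves a thin collar transversally in the future. -/
theorem IsMaximalSolution.exists_exit {G : ℝ} (hG : 0 < G) {m : Fin N → ℝ}
    (hm : ∀ a, 0 < m a) {h β L : ℝ} (hh : 0 < h) (hβ0 : 0 < β) (hL0 : 0 < L)
    {q : ℝ → Config N} {I : Set ℝ} (hq : IsMaximalSolution G m q I) {t₀ : ℝ} (ht₀ : t₀ ∈ I)
    (hE : energy G m (q t₀) (deriv q t₀) = -h)
    (hβ : ∀ t ∈ I, potential G m (q t) ≤ h + L →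
      ∃ D ≥ β, HasDerivAt (fun s => potentialDeriv G m (q s) (deriv q s)) D t)
    (hU : potential G m (q t₀) < h + L) :
    ∃ t₂ ∈ I, t₀ < t₂ ∧ potential G m (q t₂) = h + L ∧
      (∀ t ∈ Ico t₀ t₂, potential G m (q t) < h + L) ∧
      0 < fderiv ℝ (potential G m) (q t₂) (deriv q t₂) := by
  have hex : ∃ t ∈ I, t₀ ≤ t ∧ h + L ≤ potential G m (q t) := by
    by_contra! hcon
    have hI := hq.Ici_subset hG hm ht₀ (by linarith : 0 < h + L) fun t ht h0 => (hcon t ht h0).le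
    have hs : 0 < 8 * L / β := by positivity
    -- With `X = 8L/β`, a stay of length `X + 1` would force `(X + 1)² ≤ X`, which is absurd.
    have h1 := hq.1.mul_sq_le hm (x := t₀) (y := t₀ + (8 * L / β + 1)) (by linarith)
      (Icc_subset_Ici_self.trans hI) ht₀ hE hβ fun t ht => (hcon t (hI ht.1) ht.1).le
    rw [add_sub_cancel_left] at h1
    have h2 : 8 * L = β * (8 * L / β) := by field_simp
    generalize 8 * L / β = X at hs h1 h2
    rw [h2] at h1
    nlinarith [le_of_mul_le_mul_left h1 hβ0]
  obtain ⟨t, ht, h0, hUt⟩ := hex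
  have hI : Icc t₀ t ⊆ I := hq.1.ordConnected.out ht₀ ht
  obtain ⟨t₂, ht₂, hlt, heq, hbelow, hpos⟩ := exists_first_crossing
    (f := fun t => potential G m (q t))
    (f' := fun t => potentialDeriv G m (q t) (deriv q t))
    (f'' := deriv fun t => potentialDeriv G m (q t) (deriv q t)) h0
    (fun s hs => hasDerivAt_potential_comp G m (hq.1.hasDerivAt (hI hs))
      (hq.1.collisionFree s (hI hs)))
    (fun s hs hsL => by
      obtain ⟨D, -, hD⟩ := hβ s (hI hs) hsL
      exact hD.differentiableAt.hasDerivAt)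
    (fun s hs hsL => by
      obtain ⟨D, hDβ, hD⟩ := hβ s (hI hs) hsL
      rw [hD.deriv]
      exact hβ0.le.trans hDβ) hU hUt
  refine ⟨t₂, hI ht₂, hlt, heq, hbelow, ?_⟩
  rwa [fderiv_potential_apply G m (hq.1.collisionFree t₂ (hI ht₂))]

theorem exists_transversal_crossings {G : ℝ} (hG : 0 < G) {m : Fin N → ℝ}
    (hm : ∀ a, 0 < m a) {h : ℝ} (hh : 0 < h) :
    ∃ ε₀ K C : ℝ, 0 < ε₀ ∧ 1 < K ∧ 0 < C ∧
      ∀ ε : ℝ, 0 < ε → ε < ε₀ →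
        ∀ (q : ℝ → Config N) (I : Set ℝ), IsMaximalSolution G m q I →
          ∀ t₀ ∈ I, energy G m (q t₀) (deriv q t₀) = -h →
            potential G m (q t₀) ≤ h + ε →
            ∃ t₁ ∈ I, ∃ t₂ ∈ I, t₁ < t₀ ∧ t₀ < t₂ ∧ t₂ - t₁ < C * √ε ∧
              (∀ t ∈ Ioo t₁ t₂, potential G m (q t) < h + K * ε) ∧
              potential G m (q t₁) = h + K * ε ∧
              potential G m (q t₂) = h + K * ε ∧
              fderiv ℝ (potential G m) (q t₁) (deriv q t₁) < 0 ∧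
              0 < fderiv ℝ (potential G m) (q t₂) (deriv q t₂) := by
  obtain ⟨η, hη, β, hβ, H⟩ := exists_convexity_constants hG hm hh
  -- With `K = 2` the level `h + 2ε` stays in the convex zone. The stay satisfies `β (t₂ - t₁)² ≤ 16
  -- ε`, and `17` makes the time bound strict.
  refine ⟨η / 2, 2, √(17 / β), by positivity, one_lt_two, by positivity,
    fun ε hε hεη q I hq t₀ ht₀ hE hU => ?_⟩
  -- Stated for every solution because it is also applied to the time-reversed one.
  have hconv : ∀ (q : ℝ → Config N) (I : Set ℝ), IsMaximalSolution G m q I → ∀ t₀ ∈ I,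
      energy G m (q t₀) (deriv q t₀) = -h → ∀ t ∈ I, potential G m (q t) ≤ h + 2 * ε →
      ∃ D ≥ β, HasDerivAt (fun s => potentialDeriv G m (q s) (deriv q s)) D t :=
    fun q I hq t₀ ht₀ hE t ht hU =>
      H q I hq.1 t ht ((hq.1.energy_eq hm ht ht₀).trans hE) (by linarith)
  have hε2 : 0 < 2 * ε := by positivity
  obtain ⟨t₂, ht₂, hlt₂, heq₂, hlow₂, hpos₂⟩ := hq.exists_exit hG hm hh hβ hε2 ht₀ hE
    (hconv q I hq t₀ ht₀ hE) (by linarith)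
  have hderiv : ∀ t, deriv (fun s => q (-s)) t = -deriv q (-t) := fun t => deriv_comp_neg q t
  have hq' := hq.comp_neg hm
  have ht₀' : -t₀ ∈ Neg.neg ⁻¹' I := by simpa using ht₀
  have hE' : energy G m (q (- -t₀)) (deriv (fun s => q (-s)) (-t₀)) = -h := by
    rw [hderiv, neg_neg, ← hE]
    simp [energy, massInner]
  obtain ⟨s, hs, hlt₁, heq₁, hlow₁, hpos₁⟩ := hq'.exists_exit hG hm hh hβ hε2 ht₀' hE'
    (hconv _ _ hq' _ ht₀' hE') (by simpa using by linarith)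
  have hlow : ∀ t ∈ Ioo (-s) t₂, potential G m (q t) < h + 2 * ε := fun t ht => by
    rcases le_total t₀ t with h0 | h0
    · exact hlow₂ t ⟨h0, ht.2⟩
    · simpa using hlow₁ (-t) ⟨by linarith, by linarith [ht.1]⟩
  have hst : -s < t₂ := by linarith
  refine ⟨-s, hs, t₂, ht₂, by linarith, hlt₂, ?_, hlow, heq₁, heq₂, ?_, hpos₂⟩
  · have h1 := hq.1.mul_sq_le hm hst.le (hq.1.ordConnected.out hs ht₂) ht₀ hE
      (hconv q I hq t₀ ht₀ hE) fun t ht => by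
        rcases ht.1.eq_or_lt with rfl | h1
        · exact heq₁.le
        rcases ht.2.eq_or_lt with rfl | h2
        · exact heq₂.le
        exact (hlow t ⟨h1, h2⟩).le
    rw [← Real.sqrt_mul (by positivity)]
    refine Real.lt_sqrt_of_sq_lt ?_
    rw [div_mul_eq_mul_div, lt_div_iff₀ hβ]
    linarith
  · rw [hderiv, map_neg] at hpos₁
    linarith

end NBody
end

theorem mainTheorem2 (N : ℕ) (G : ℝ) (hG : 0 < G) (m : Fin N → ℝ) (hm : ∀ a, 0 < m a)
    (h : ℝ) (hh : 0 < h) :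
    -- every energy `-h` solution starting in a thin enough collar leaves it in finite time
    (∃ ε : ℝ, 0 < ε ∧
      ∀ (q : ℝ → NBody.Config N) (I : Set ℝ), NBody.IsMaximalSolution G m q I →
        ∀ t₀ ∈ I, NBody.energy G m (q t₀) (deriv q t₀) = -h →
          q t₀ ∈ NBody.hillCollar G m h ε →
          ∃ t ∈ I, t₀ < t ∧ q t ∉ NBody.hillCollar G m h ε) ∧
    -- the stronger form, with transversal crossings in both time directions and a time bound
    (∃ ε₀ K C : ℝ, 0 < ε₀ ∧ 1 < K ∧ 0 < C ∧
      ∀ ε : ℝ, 0 < ε → ε < ε₀ →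
        ∀ (q : ℝ → NBody.Config N) (I : Set ℝ), NBody.IsMaximalSolution G m q I →
          ∀ t₀ ∈ I, NBody.energy G m (q t₀) (deriv q t₀) = -h →
            NBody.potential G m (q t₀) ≤ h + ε →
            ∃ t₁ ∈ I, ∃ t₂ ∈ I, t₁ < t₀ ∧ t₀ < t₂ ∧ t₂ - t₁ < C * Real.sqrt ε ∧
              (∀ t ∈ Set.Ioo t₁ t₂, NBody.potential G m (q t) < h + K * ε) ∧
              NBody.potential G m (q t₁) = h + K * ε ∧
              NBody.potential G m (q t₂) = h + K * ε ∧
              fderiv ℝ (NBody.potential G m) (q t₁) (deriv q t₁) < 0 ∧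
              0 < fderiv ℝ (NBody.potential G m) (q t₂) (deriv q t₂)) := by
  have key := NBody.exists_transversal_crossings hG hm hh
  refine ⟨?_, key⟩
  obtain ⟨ε₀, K, C, hε₀, hK, -, H⟩ := key
  -- Any width below `ε₀` works: at the exit time `U = h + K ε > h + ε`, since `K > 1`.
  refine ⟨ε₀ / 2, half_pos hε₀, fun q I hq t₀ ht₀ hE hcol => ?_⟩
  obtain ⟨-, -, t₂, ht₂, -, hlt, -, -, -, heq, -, -⟩ :=
    H (ε₀ / 2) (half_pos hε₀) (half_lt_self hε₀) q I hq t₀ ht₀ hE hcol.2.2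
  refine ⟨t₂, ht₂, hlt, fun hmem => ?_⟩
  have h1 := hmem.2.2
  rw [heq] at h1
  have h2 := mul_lt_mul_of_pos_right hK (half_pos hε₀)
  linarith
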